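/- Let $n$ be a natural number, $\mathbb{T}^n=\mathbb{R}^n/\mathbb{Z}^n$, and for $i=1,2$ let $F_i:\mathbb{T}^n\times\mathbb{R}^n\to\mathbb{R}$ and $f_i:\mathbb{T}^n\to\mathbb{R}$ be continuous functions. Put $H_i(x,p)=F_i(x,p)-f_i(x)$ and $\mathcal{A}=\{x\in\mathbb{T}^n : f_1(x)=f_2(x)=0\}$, and assume that for $i=1,2$: (A1) $\lim_{r\to\infty}\inf\{H_i(x,p) : x\in\mathbb{T}^n,\ |p|\ge r\}=\infty$; (A2) $f_i(x)\ge 0$ for all $x\in\mathbb{T}^n$; (A3) $\mathcal{A}\neq\emptyset$; (A4) there exists $\lambda_0\in(0,1)$ such that $F_i(x,\lambda p)\le\lambda F_i(x,p)$ for all $\lambda\in[\lambda_0,1]$, $x\in\mathbb{T}^n\setminus\mathcal{A}$ and $p\in\mathbb{R}^n$; (A5) $F_i(x,p)\ge 0$ for all $(x,p)\in\mathbb{T}^n\times\mathbb{R}^n$, and $F_i(x,0)=0$ for all $x\in\mathbb{T}^n$. Call $c\in\mathbb{R}$ an ergodic constant if there exist $v_1,v_2\in C(\mathbb{T}^n)$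 such that $(v_1,v_2)$ is a viscosity solution of $$\text{(E)}\qquad H_1(x,Dv_1)+v_1-v_2=c,\qquad H_2(x,Dv_2)+v_2-v_1=c\qquad\text{in }\mathbb{T}^n.$$ Then the ergodic constant exists, is unique, and is equal to $0$: the system (E) with $c=0$ has a viscosity solution $(v_1,v_2)\in C(\mathbb{T}^n)^2$, and if (E) has a viscosity solution in $C(\mathbb{T}^n)^2$ for some $c\in\mathbb{R}$, then $c=0$. -/

import Mathlib

/-- The covering map `ℝⁿ → 𝕋ⁿ = ℝⁿ/ℤⁿ`. -/
def torusProj {n : ℕ} (x : EuclideanSpace ℝ (Fin n)) : UnitAddTorus (Fin n) :=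
  fun i => (x i : UnitAddCircle)

/-- Coercivity of a Hamiltonian: `inf {H(x,p) | x ∈ 𝕋ⁿ, |p| ≥ r} → ∞` as `r → ∞`
(the infimum over the empty set being `+∞`). -/
def IsCoerciveHamiltonian {n : ℕ}
    (H : UnitAddTorus (Fin n) → EuclideanSpace ℝ (Fin n) → ℝ) : Prop :=
  ∀ M : ℝ, ∃ r : ℝ, ∀ (x : UnitAddTorus (Fin n)) (p : EuclideanSpace ℝ (Fin n)),
    r ≤ ‖p‖ → M ≤ H x p

/-- `v` is a viscosity subsolution of the equation `H(x, Dv) + v - w = c` on `𝕋ⁿ`, where `w` is a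
given function. Test functions are `C¹` functions on `ℝⁿ`, touching the periodic lift of `v`
locally; this is the usual notion in the local coordinates of `𝕋ⁿ`. -/
def IsViscositySubsolution {n : ℕ}
    (H : UnitAddTorus (Fin n) → EuclideanSpace ℝ (Fin n) → ℝ) (c : ℝ)
    (v w : UnitAddTorus (Fin n) → ℝ) : Prop :=
  ∀ (φ : EuclideanSpace ℝ (Fin n) → ℝ) (x : EuclideanSpace ℝ (Fin n)),
    ContDiff ℝ 1 φ → IsLocalMax (fun y => v (torusProj y) - φ y) x →
      H (torusProj x) (gradient φ x) + v (torusProj x) - w (torusProj x) ≤ c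

/-- `v` is a viscosity supersolution of the equation `H(x, Dv) + v - w = c` on `𝕋ⁿ`, where `w` is a
given function. -/
def IsViscositySupersolution {n : ℕ}
    (H : UnitAddTorus (Fin n) → EuclideanSpace ℝ (Fin n) → ℝ) (c : ℝ)
    (v w : UnitAddTorus (Fin n) → ℝ) : Prop :=
  ∀ (φ : EuclideanSpace ℝ (Fin n) → ℝ) (x : EuclideanSpace ℝ (Fin n)),
    ContDiff ℝ 1 φ → IsLocalMin (fun y => v (torusProj y) - φ y) x →
      c ≤ H (torusProj x) (gradient φ x) + v (torusProj x) - w (torusProj x)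

/-- The pair of continuous functions `(v₁, v₂)` is a viscosity solution of the ergodic system
`H₁(x, Dv₁) + v₁ - v₂ = c`, `H₂(x, Dv₂) + v₂ - v₁ = c` on `𝕋ⁿ`. -/
structure SolvesErgodicSystem {n : ℕ}
    (H₁ H₂ : UnitAddTorus (Fin n) → EuclideanSpace ℝ (Fin n) → ℝ)
    (v₁ v₂ : C(UnitAddTorus (Fin n), ℝ)) (c : ℝ) : Prop where
  sub₁ : IsViscositySubsolution H₁ c v₁ v₂
  super₁ : IsViscositySupersolution H₁ c v₁ v₂
  sub₂ : IsViscositySubsolution H₂ c v₂ v₁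
  super₂ : IsViscositySupersolution H₂ c v₂ v₁

/-- `c` is an ergodic constant: the ergodic system with right-hand side `c` has a continuous
viscosity solution. -/
def IsErgodicConstant {n : ℕ}
    (H₁ H₂ : UnitAddTorus (Fin n) → EuclideanSpace ℝ (Fin n) → ℝ) (c : ℝ) : Prop :=
  ∃ v₁ v₂ : C(UnitAddTorus (Fin n), ℝ), SolvesErgodicSystem H₁ H₂ v₁ v₂ c

open Filter Topology Set

/-! ### Viscosity subsolutions on a Euclidean space: touching, Lipschitz bounds, suprema, bumps. -/

section Viscosity

variable {E : Type*} [NormedAddCommGroup E]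

/-! Existence is Perron's method, run on the lift to `ℝⁿ`, with both components pinned to be
nonpositive over one common zero of `f₁` and `f₂`. As `Fᵢ ≥ 0`, subsolutions satisfy `u₂ - u₁ ≤ f₂`
and `u₁ - u₂ ≤ f₁` pointwise (`sub_le_of_nonneg`). This bounds the coupling, so coercivity makes all
competitors equi-Lipschitz (`exists_lipschitz_constant`). Their supremum is a subsolution
(`IsSubsolution.of_approx`). Off the pinned set it is a supersolution, since otherwise a bump would
enlarge it (`IsPerronPair.supersolution`). On the pinned set both components and both `fᵢ` vanish,
so the supersolution inequality is just `Fᵢ ≥ 0`.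

Uniqueness compares two points: a common zero of the `fᵢ` gives `c ≥ 0`, and a minimum point of the
component with the smaller minimum gives `c ≤ 0`. -/

theorem exists_forall_sub_norm_sq_le [ProperSpace E] {u : E → ℝ} (hu : Continuous u) (hb : BddAbove (range u))
    {k : ℝ} (hk : 0 < k) (x : E) :
    ∃ y, ∀ z, u z - k * ‖z - x‖ ^ 2 ≤ u y - k * ‖y - x‖ ^ 2 := by
  obtain ⟨M, hM⟩ := hb
  have hM' : ∀ z, u z ≤ M := fun z => hM ⟨z, rfl⟩
  have hc : Continuous fun z => u z - k * ‖z - x‖ ^ 2 := by fun_prop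
  refine hc.exists_forall_ge' x ?_
  have : Tendsto (fun z : E => ‖z - x‖) (cocompact E) atTop := by
    simpa [dist_eq_norm] using tendsto_dist_right_cocompact_atTop x
  filter_upwards [this.eventually_ge_atTop (max 1 ((M - u x) / k))] with z hz
  have h1 := (le_max_left _ _).trans hz
  have h2 := (le_max_right _ _).trans hz
  rw [div_le_iff₀ hk] at h2
  have h3 : ‖z - x‖ ≤ ‖z - x‖ ^ 2 := by nlinarith
  have h4 := hM' z
  have h5 := mul_le_mul_of_nonneg_left h3 hk.le
  simp only [sub_self, norm_zero]
  linarith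

variable [InnerProductSpace ℝ E]

theorem contDiff_const_mul_norm_sub_sq (k : ℝ) (x₀ : E) :
    ContDiff ℝ 1 (fun y : E => k * ‖y - x₀‖ ^ 2) :=
  contDiff_const.mul ((contDiff_id.sub contDiff_const).norm_sq ℝ)

/-- Cutting the segment into `N + 1` equal pieces divides the total quadratic error by `N + 1`. -/
theorem le_add_of_le_add_sq {w : E → ℝ} {R k : ℝ}
    (h : ∀ x y, w x ≤ w y + R * ‖x - y‖ + k * ‖x - y‖ ^ 2) (x y : E) :
    w x ≤ w y + R * ‖x - y‖ := by
  have key : ∀ N : ℕ, w x ≤ w y + R * ‖x - y‖ + k * ‖x - y‖ ^ 2 * (1 / ((N : ℝ) + 1)) := by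
    intro N
    have hN : (0 : ℝ) < N + 1 := by positivity
    have ind : ∀ i : ℕ, w (y + ((i : ℝ) / (N + 1)) • (x - y)) ≤
        w y + i * (R * ‖x - y‖ / (N + 1) + k * ‖x - y‖ ^ 2 / (N + 1) ^ 2) := by
      intro i
      induction i with
      | zero => simp
      | succ i ih =>
        have h1 := h (y + (((i + 1 : ℕ) : ℝ) / (N + 1)) • (x - y))
          (y + ((i : ℝ) / (N + 1)) • (x - y))
        have h2 : y + (((i + 1 : ℕ) : ℝ) / (N + 1)) • (x - y) -
            (y + ((i : ℝ) / (N + 1)) • (x - y)) = (1 / ((N : ℝ) + 1)) • (x - y) := by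
          rw [add_sub_add_left_eq_sub, ← sub_smul]
          congr 1
          push_cast
          ring
        rw [h2, norm_smul, Real.norm_of_nonneg (by positivity)] at h1
        refine h1.trans ((add_le_add_left (add_le_add_left ih _) _).trans_eq ?_)
        push_cast
        field_simp
        ring
    have h1 := ind (N + 1)
    have h2 : (((N + 1 : ℕ) : ℝ) / (N + 1)) = 1 := by
      push_cast
      exact div_self hN.ne'
    rw [h2, one_smul, add_sub_cancel] at h1
    refine h1.trans_eq ?_
    push_cast
    field_simp
    ring
  have lim : Tendsto (fun N : ℕ =>
      w y + R * ‖x - y‖ + k * ‖x - y‖ ^ 2 * (1 / ((N : ℝ) + 1))) atTop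
      (𝓝 (w y + R * ‖x - y‖ + k * ‖x - y‖ ^ 2 * 0)) :=
    (tendsto_one_div_add_atTop_nhds_zero_nat.const_mul _).const_add _
  simpa using ge_of_tendsto' lim key

variable [ProperSpace E]

theorem hasGradientAt_const_mul_norm_sub_sq (k : ℝ) (x₀ x : E) :
    HasGradientAt (fun y => k * ‖y - x₀‖ ^ 2) ((2 * k) • (x - x₀)) x := by
  have h : HasFDerivAt (fun y : E => y - x₀) (ContinuousLinearMap.id ℝ E) x :=
    (hasFDerivAt_id x).sub_const x₀
  rw [hasGradientAt_iff_hasFDerivAt]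
  refine (h.norm_sq.const_mul k).congr_fderiv ?_
  ext y
  simp
  ring

theorem ContDiff.hasGradientAt {φ : E → ℝ} (h : ContDiff ℝ 1 φ) (x : E) :
    HasGradientAt φ (gradient φ x) x :=
  ((h.differentiable one_ne_zero) x).hasGradientAt

theorem ContDiff.continuous_gradient {φ : E → ℝ} (h : ContDiff ℝ 1 φ) :
    Continuous (gradient φ) :=
  (InnerProductSpace.toDual ℝ E).symm.continuous.comp (h.continuous_fderiv one_ne_zero)

theorem gradient_add_const_mul_norm_sub_sq {φ : E → ℝ} (h : ContDiff ℝ 1 φ) (a k : ℝ) (x₀ x : E) :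
    gradient (fun y => φ y + a + k * ‖y - x₀‖ ^ 2) x = gradient φ x + (2 * k) • (x - x₀) := by
  have h₁ := (h.hasGradientAt x).hasFDerivAt
  have h₂ := (hasGradientAt_const_mul_norm_sub_sq k x₀ x).hasFDerivAt
  refine HasGradientAt.gradient ?_
  rw [hasGradientAt_iff_hasFDerivAt, map_add]
  exact (h₁.add_const a).add h₂

/-- Two `C¹` functions touching at a point have the same gradient there. -/
theorem gradient_eq_of_isLocalMax_sub {φ ψ : E → ℝ} (hφ : ContDiff ℝ 1 φ) (hψ : ContDiff ℝ 1 ψ)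
    {x : E} (h : IsLocalMax (fun y => ψ y - φ y) x) : gradient ψ x = gradient φ x := by
  have h₁ := h.hasFDerivAt_eq_zero
    ((hψ.hasGradientAt x).hasFDerivAt.sub (hφ.hasGradientAt x).hasFDerivAt)
  rw [← map_sub, LinearIsometryEquiv.map_eq_zero_iff] at h₁
  exact sub_eq_zero.1 h₁

/-- Viscosity subsolutions of `G(x, Dv) + v - w = 0` on the whole space. -/
def IsSubsolution (G : E → E → ℝ) (v w : E → ℝ) : Prop :=
  ∀ (φ : E → ℝ) (x : E), ContDiff ℝ 1 φ → IsLocalMax (fun y => v y - φ y) x →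
    G x (gradient φ x) + v x - w x ≤ 0

/-- An inequality between continuous functions that holds where a continuous function can be
touched from above by `C¹` functions holds everywhere. -/
theorem nonpos_of_isLocalMax {u g : E → ℝ} (hu : Continuous u) (hb : BddAbove (range u))
    (hg : Continuous g)
    (h : ∀ (φ : E → ℝ) (x : E), ContDiff ℝ 1 φ → IsLocalMax (fun y => u y - φ y) x → g x ≤ 0)
    (x : E) : g x ≤ 0 := by
  by_contra! hx
  obtain ⟨ε, hε, hball⟩ := Metric.eventually_nhds_iff.1 (hg.continuousAt.eventually_const_lt hx)
  have hb' := hb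
  obtain ⟨M, hM⟩ := hb
  have hM' : ∀ z, u z ≤ M := fun z => hM ⟨z, rfl⟩
  -- With this weight the penalty at distance `ε` exceeds `M - u x`, so the penalised maximum lies
  -- within `ε` of `x`.
  have hk : 0 < (M - u x + 1) / ε ^ 2 := by
    have := hM' x
    have : 0 < M - u x + 1 := by linarith
    positivity
  obtain ⟨y, hy⟩ := exists_forall_sub_norm_sq_le hu hb' hk x
  have hgy := h _ y (contDiff_const_mul_norm_sub_sq _ x) (Eventually.of_forall hy)
  refine (hball (y := y) ?_).not_ge hgy
  rw [dist_eq_norm]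
  have h1 := hy x
  have h2 := hM' y
  by_contra! h3
  have h4 : ε ^ 2 ≤ ‖y - x‖ ^ 2 := by gcongr
  have h5 := mul_le_mul_of_nonneg_left h4 hk.le
  rw [div_mul_cancel₀ _ (by positivity)] at h5
  simp only [sub_self, norm_zero] at h1
  linarith

/-- A viscosity subsolution of `|Du| ≤ R` is `R`-Lipschitz. -/
theorem le_add_mul_norm_of_norm_gradient_le {u : E → ℝ} (hu : Continuous u)
    (hb : BddAbove (range u)) {R : ℝ}
    (h : ∀ (φ : E → ℝ) (x : E), ContDiff ℝ 1 φ → IsLocalMax (fun y => u y - φ y) x →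
      ‖gradient φ x‖ ≤ R) (x y : E) : u x ≤ u y + R * ‖x - y‖ := by
  refine le_of_forall_pos_le_add fun ε hε => ?_
  obtain ⟨δ, hδ, hball⟩ := Metric.eventually_nhds_iff.1
    (hu.continuousAt.eventually_lt_const (show u y < u y + ε by linarith))
  obtain ⟨k, hk0, hk⟩ : ∃ k : ℝ, 0 < k ∧ R < 2 * k * δ := by
    refine ⟨(|R| + 1) / (2 * δ), by positivity, ?_⟩
    have : 2 * ((|R| + 1) / (2 * δ)) * δ = |R| + 1 := by field_simp
    rw [this]
    linarith [le_abs_self R]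
  -- `Y z` realises the sup-convolution of `u` at `z`. The gradient bound at `Y z` makes the
  -- sup-convolution Lipschitz up to a quadratic error, and keeps `Y y` within `δ` of `y`.
  choose Y hY using exists_forall_sub_norm_sq_le hu hb hk0
  have hR : ∀ z, 2 * k * ‖Y z - z‖ ≤ R := fun z => by
    have := h _ (Y z) (contDiff_const_mul_norm_sub_sq k z) (Eventually.of_forall (hY z))
    rwa [(hasGradientAt_const_mul_norm_sub_sq k z (Y z)).gradient, norm_smul,
      Real.norm_of_nonneg (by positivity)] at this
  have key := le_add_of_le_add_sq (w := fun z => u (Y z) - k * ‖Y z - z‖ ^ 2) (R := R) (k := k)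
    (fun a b => by
      have h1 := hY b (Y a)
      have h2 : ‖Y a - b‖ ≤ ‖Y a - a‖ + ‖a - b‖ := norm_sub_le_norm_sub_add_norm_sub _ _ _
      have h3 : ‖Y a - b‖ ^ 2 ≤ (‖Y a - a‖ + ‖a - b‖) ^ 2 := by gcongr
      have h4 := mul_le_mul_of_nonneg_left h3 hk0.le
      have h5 := mul_le_mul_of_nonneg_right (hR a) (norm_nonneg (a - b))
      nlinarith) x y
  have h1 := hY x x
  have h2 : u (Y y) < u y + ε := by
    refine hball ?_
    rw [dist_eq_norm]
    have := hR y
    by_contra! h3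
    have := mul_le_mul_of_nonneg_left h3 (show 0 ≤ 2 * k by positivity)
    linarith
  have h3 : 0 ≤ k * ‖Y y - y‖ ^ 2 := by positivity
  simp only [sub_self, norm_zero] at h1 key
  linarith

/-- A supremum of subsolutions is a subsolution, monotonically in the coupling term. -/
theorem IsSubsolution.of_approx {G : E → E → ℝ} (hG : Continuous (Function.uncurry G))
    {v w : E → ℝ} (hv : Continuous v) (hw : Continuous w)
    (h : ∀ x, ∀ ε > 0, ∃ u u' : E → ℝ, Continuous u ∧ IsSubsolution G u u' ∧ (∀ y, u y ≤ v y) ∧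
      (∀ y, u' y ≤ w y) ∧ v x - ε < u x) : IsSubsolution G v w := by
  intro φ x hφ hmax
  by_contra! hpos
  -- The quadratic term makes the maximum strict without changing the gradient at `x`.
  set φ' : E → ℝ := fun y => φ y + 0 + 1 * ‖y - x‖ ^ 2 with hφ'
  have hφ'c : ContDiff ℝ 1 φ' :=
    (hφ.add contDiff_const).add (contDiff_const_mul_norm_sub_sq 1 x)
  have hgrad : gradient φ' x = gradient φ x := by
    rw [hφ', gradient_add_const_mul_norm_sub_sq hφ, sub_self, smul_zero, add_zero]
  set g : E → ℝ := fun y => G y (gradient φ' y) + v y - w y with hg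
  have hgc : Continuous g := by
    have : Continuous fun y => G y (gradient φ' y) :=
      hG.comp (continuous_id.prodMk hφ'c.continuous_gradient)
    exact (this.add hv).sub hw
  have hgx : 0 < g x := by simpa only [hg, hgrad] using hpos
  obtain ⟨δ, hδ, hball⟩ := Metric.nhds_basis_closedBall.eventually_iff.1
    ((hgc.continuousAt.eventually_const_lt (half_lt_self hgx)).and hmax)
  -- `δ ^ 2` keeps the maximum point of `u - φ'` off the sphere; `g x / 2` makes the error `v - u`
  -- there too small to absorb `g`.
  set ε := min (g x / 2) (δ ^ 2) with hε
  have hε0 : 0 < ε := lt_min (by positivity) (by positivity)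
  obtain ⟨u, u', hu, hsub, huv, huw, hux⟩ := h x ε hε0
  obtain ⟨y, hy, hymax⟩ := (isCompact_closedBall x δ).exists_isMaxOn
    ⟨x, Metric.mem_closedBall_self hδ.le⟩ (hu.sub hφ'c.continuous).continuousOn
  have h1 : u x - φ' x ≤ u y - φ' y := hymax (Metric.mem_closedBall_self hδ.le)
  have h2 := (hball hy).2
  have h3 := huv y
  simp only [hφ', sub_self, norm_zero] at h1
  have h4 : 0 ≤ ‖y - x‖ ^ 2 := by positivity
  have hyδ : ‖y - x‖ ^ 2 < δ ^ 2 := by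
    have := min_le_right (g x / 2) (δ ^ 2)
    linarith
  have hyb : y ∈ Metric.ball x δ := by
    rw [Metric.mem_ball, dist_eq_norm]
    exact lt_of_pow_lt_pow_left₀ 2 hδ.le hyδ
  have hloc : IsLocalMax (fun z => u z - φ' z) y := by
    filter_upwards [Metric.isOpen_ball.mem_nhds hyb] with z hz
    exact hymax (Metric.ball_subset_closedBall hz)
  have h5 := hsub φ' y hφ'c hloc
  have h6 := (hball hy).1
  have h7 := huw y
  have h8 := min_le_left (g x / 2) (δ ^ 2)
  simp only [hg] at h6 h8 hε
  linarith

open scoped Classical in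
/-- Perron's bump construction: a subsolution that fails to be a supersolution at a point can be
increased near that point. -/
theorem IsSubsolution.exists_bump {G : E → E → ℝ} (hG : Continuous (Function.uncurry G))
    {v w φ : E → ℝ} (hv : Continuous v) (hw : Continuous w) (hsub : IsSubsolution G v w)
    (hφ : ContDiff ℝ 1 φ) {x : E} (hmin : IsLocalMin (fun y => v y - φ y) x)
    (hneg : G x (gradient φ x) + v x - w x < 0) {U : Set E} (hU : U ∈ 𝓝 x) :
    ∃ v' : E → ℝ, Continuous v' ∧ IsSubsolution G v' w ∧ (∀ y, v y ≤ v' y) ∧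
      (∀ y, v' y ≤ v y + 1) ∧ (∀ y ∉ U, v' y = v y) ∧ v x < v' x := by
  set ψ₀ : E → ℝ := fun y => φ y + (v x - φ x) + -1 * ‖y - x‖ ^ 2 with hψ₀
  have hψ₀c : ContDiff ℝ 1 ψ₀ :=
    (hφ.add contDiff_const).add (contDiff_const_mul_norm_sub_sq (-1) x)
  have hgrad : gradient ψ₀ x = gradient φ x := by
    rw [hψ₀, gradient_add_const_mul_norm_sub_sq hφ, sub_self, smul_zero, add_zero]
  set g : E → ℝ := fun y => G y (gradient ψ₀ y) + ψ₀ y - w y with hg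
  have hgc : Continuous g := by
    have : Continuous fun y => G y (gradient ψ₀ y) :=
      hG.comp (continuous_id.prodMk hψ₀c.continuous_gradient)
    exact (this.add hψ₀c.continuous).sub hw
  have hψ₀x : ψ₀ x = v x := by simp [hψ₀]
  have hgx : g x < 0 := by simpa only [hg, hgrad, hψ₀x] using hneg
  obtain ⟨r, hr, hball⟩ := Metric.nhds_basis_ball.eventually_iff.1
    ((hgc.continuousAt.eventually_lt_const (show g x < g x / 2 by linarith)).and
      (hmin.and (eventually_mem_set.2 hU)))
  -- The three bounds in turn: the raised `ψ` stays a subsolution on the ball, the increase is at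
  -- most `1`, and `ψ ≤ v` outside the half-radius ball, so the gluing is continuous.
  obtain ⟨δ, hδ, hδg, hδ1, hδr⟩ : ∃ δ : ℝ, 0 < δ ∧ δ ≤ -(g x / 2) ∧ δ ≤ 1 ∧ δ ≤ (r / 2) ^ 2 :=
    ⟨min (-(g x / 2)) (min 1 ((r / 2) ^ 2)),
      lt_min (by linarith) (lt_min one_pos (by positivity)), min_le_left _ _,
      (min_le_right _ _).trans (min_le_left _ _), (min_le_right _ _).trans (min_le_right _ _)⟩
  set ψ : E → ℝ := fun y => ψ₀ y + δ with hψ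
  have hψc : ContDiff ℝ 1 ψ := hψ₀c.add contDiff_const
  have hψgrad : ∀ y, gradient ψ y = gradient ψ₀ y := fun y =>
    HasGradientAt.gradient ((hψ₀c.hasGradientAt y).hasFDerivAt.add_const δ)
  have hψv : ∀ y ∈ Metric.ball x r, ψ y + ‖y - x‖ ^ 2 ≤ v y + δ := fun y hy => by
    have := (hball hy).2.1
    simp only [hψ, hψ₀]
    linarith
  set v' : E → ℝ := (Metric.ball x r).piecewise (fun y => max (v y) (ψ y)) v with hv'
  have hin : ∀ y ∈ Metric.ball x r, v' y = max (v y) (ψ y) := fun y hy =>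
    piecewise_eq_of_mem _ _ _ hy
  have hout : ∀ y ∉ Metric.closedBall x (r / 2), v' y = v y := fun y hy => by
    by_cases hyr : y ∈ Metric.ball x r
    · rw [hin y hyr, max_eq_left]
      rw [Metric.mem_closedBall, not_le, dist_eq_norm] at hy
      have h1 := hψv y hyr
      have h2 : (r / 2) ^ 2 ≤ ‖y - x‖ ^ 2 := by gcongr
      linarith
    · exact piecewise_eq_of_notMem _ _ _ hyr
  have hle : ∀ y, v y ≤ v' y := fun y => by
    by_cases hyr : y ∈ Metric.ball x r
    · rw [hin y hyr]
      exact le_max_left _ _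
    · exact (piecewise_eq_of_notMem _ _ _ hyr).ge
  refine ⟨v', ?_, ?_, hle, ?_, ?_, ?_⟩
  · rw [continuous_iff_continuousAt]
    intro y
    by_cases hy : y ∈ Metric.closedBall x (r / 2)
    · have hyr : y ∈ Metric.ball x r := Metric.closedBall_subset_ball (by linarith) hy
      refine (hv.max hψc.continuous).continuousAt.congr ?_
      filter_upwards [Metric.isOpen_ball.mem_nhds hyr] with z hz
      exact (hin z hz).symm
    · refine hv.continuousAt.congr ?_
      filter_upwards [Metric.isClosed_closedBall.isOpen_compl.mem_nhds hy] with z hz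
      exact (hout z hz).symm
  · intro χ y hχ hmax
    rcases (hle y).eq_or_lt with heq | hlt
    · rw [← heq]
      refine hsub χ y hχ ?_
      filter_upwards [hmax] with z hz
      have := hle z
      linarith
    · have hyr : y ∈ Metric.ball x r := by
        by_contra hyr
        exact hlt.ne (piecewise_eq_of_notMem _ _ _ hyr).symm
      have hvy : v' y = ψ y := by
        rw [hin y hyr] at hlt ⊢
        exact max_eq_right ((lt_max_iff.1 hlt).resolve_left (lt_irrefl _)).le
      have hloc : IsLocalMax (fun z => ψ z - χ z) y := by
        filter_upwards [hmax, Metric.isOpen_ball.mem_nhds hyr] with z hz hzr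
        have := (le_max_right (v z) (ψ z)).trans (hin z hzr).ge
        linarith
      have h1 := gradient_eq_of_isLocalMax_sub hχ hψc hloc
      have h2 := (hball hyr).1
      rw [hvy, ← h1, hψgrad]
      simp only [hg, hψ] at h2 hδg ⊢
      linarith
  · intro y
    by_cases hyr : y ∈ Metric.ball x r
    · rw [hin y hyr]
      refine max_le (by linarith) ?_
      have := hψv y hyr
      nlinarith [sq_nonneg ‖y - x‖]
    · rw [show v' y = v y from piecewise_eq_of_notMem _ _ _ hyr]
      linarith
  · intro y hy
    exact piecewise_eq_of_notMem _ _ _ fun hyr => hy (hball hyr).2.2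
  · rw [hin x (Metric.mem_ball_self hr)]
    refine lt_max_of_lt_right ?_
    simp only [hψ, hψ₀x]
    linarith

end Viscosity

/-! ### Perron's method for the coupled system. -/

section Perron

variable {E : Type*} [NormedAddCommGroup E] [InnerProductSpace ℝ E] [ProperSpace E]

theorem IsSubsolution.comp_add_right {G : E → E → ℝ} {v w : E → ℝ} (h : IsSubsolution G v w) {k : E}
    (hG : ∀ x p, G (x + k) p = G x p) :
    IsSubsolution G (fun y => v (y + k)) (fun y => w (y + k)) := by
  intro φ x hφ hmax
  have h₁ : ContDiff ℝ 1 fun y => φ (y - k) := hφ.comp (contDiff_id.sub contDiff_const)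
  have h₂ : gradient (fun y => φ (y - k)) (x + k) = gradient φ x := by
    simp only [gradient, fderiv_comp_sub, add_sub_cancel_right]
  have h₃ : Tendsto (fun y => y - k) (𝓝 (x + k)) (𝓝 x) := by
    simpa using (continuous_sub_right k).tendsto (x + k)
  have h₄ := h _ (x + k) h₁ ((h₃.eventually hmax).mono fun y hy => by simpa using hy)
  rwa [h₂, hG] at h₄

/-- The pairs of functions over which the Perron supremum is taken: subsolutions of the system that
are nonpositive on `Z`. -/
structure IsPerronPair (G₁ G₂ : E → E → ℝ) (Z : Set E) (u₁ u₂ : E → ℝ) : Prop where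
  cont₁ : Continuous u₁
  cont₂ : Continuous u₂
  bdd₁ : BddAbove (range u₁)
  bdd₂ : BddAbove (range u₂)
  sub₁ : IsSubsolution G₁ u₁ u₂
  sub₂ : IsSubsolution G₂ u₂ u₁
  nonpos₁ : ∀ z ∈ Z, u₁ z ≤ 0
  nonpos₂ : ∀ z ∈ Z, u₂ z ≤ 0

variable {G₁ G₂ : E → E → ℝ} {Z : Set E} {u₁ u₂ v₁ v₂ : E → ℝ}

theorem IsPerronPair.symm (h : IsPerronPair G₁ G₂ Z u₁ u₂) : IsPerronPair G₂ G₁ Z u₂ u₁ :=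
  ⟨h.cont₂, h.cont₁, h.bdd₂, h.bdd₁, h.sub₂, h.sub₁, h.nonpos₂, h.nonpos₁⟩

theorem IsPerronPair.comp_add_right (h : IsPerronPair G₁ G₂ Z u₁ u₂) {k : E}
    (hG₁ : ∀ x p, G₁ (x + k) p = G₁ x p) (hG₂ : ∀ x p, G₂ (x + k) p = G₂ x p)
    (hZ : ∀ z ∈ Z, z + k ∈ Z) :
    IsPerronPair G₁ G₂ Z (fun y => u₁ (y + k)) (fun y => u₂ (y + k)) where
  cont₁ := h.cont₁.comp (continuous_add_const k)
  cont₂ := h.cont₂.comp (continuous_add_const k)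
  bdd₁ := h.bdd₁.mono (range_comp_subset_range (· + k) u₁)
  bdd₂ := h.bdd₂.mono (range_comp_subset_range (· + k) u₂)
  sub₁ := h.sub₁.comp_add_right hG₁
  sub₂ := h.sub₂.comp_add_right hG₂
  nonpos₁ z hz := h.nonpos₁ _ (hZ z hz)
  nonpos₂ z hz := h.nonpos₂ _ (hZ z hz)

/-- The supremum of an equi-Lipschitz family of Perron pairs. -/
theorem exists_perron_sup (hG₁ : Continuous (Function.uncurry G₁))
    (hG₂ : Continuous (Function.uncurry G₂)) (hZ : Z.Nonempty) {R : ℝ}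
    (hR : ∀ u₁ u₂, IsPerronPair G₁ G₂ Z u₁ u₂ → ∀ x y,
      u₁ x ≤ u₁ y + R * ‖x - y‖ ∧ u₂ x ≤ u₂ y + R * ‖x - y‖)
    (h0 : IsPerronPair G₁ G₂ Z (fun _ => 0) (fun _ => 0)) :
    ∃ v₁ v₂ : E → ℝ, Continuous v₁ ∧ Continuous v₂ ∧
      IsSubsolution G₁ v₁ v₂ ∧ IsSubsolution G₂ v₂ v₁ ∧
      (∀ u₁ u₂, IsPerronPair G₁ G₂ Z u₁ u₂ → ∀ y, u₁ y ≤ v₁ y ∧ u₂ y ≤ v₂ y) ∧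
      (∀ z ∈ Z, v₁ z = 0 ∧ v₂ z = 0) ∧
      ∀ k, (∀ u₁ u₂, IsPerronPair G₁ G₂ Z u₁ u₂ →
          IsPerronPair G₁ G₂ Z (fun y => u₁ (y + k)) (fun y => u₂ (y + k))) →
        ∀ y, v₁ (y + k) ≤ v₁ y ∧ v₂ (y + k) ≤ v₂ y := by
  obtain ⟨z₀, hz₀⟩ := hZ
  let S := {u : (E → ℝ) × (E → ℝ) // IsPerronPair G₁ G₂ Z u.1 u.2}
  let u₀ : S := ⟨(fun _ => 0, fun _ => 0), h0⟩
  have : Nonempty S := ⟨u₀⟩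
  -- The pinning at `z₀` and the common Lipschitz constant bound the family pointwise.
  have hb₁ : ∀ y, BddAbove (range fun u : S => u.1.1 y) := fun y =>
    ⟨R * ‖y - z₀‖, forall_mem_range.2 fun u => by
      linarith [(hR _ _ u.2 y z₀).1, u.2.nonpos₁ z₀ hz₀]⟩
  have hb₂ : ∀ y, BddAbove (range fun u : S => u.1.2 y) := fun y =>
    ⟨R * ‖y - z₀‖, forall_mem_range.2 fun u => by
      linarith [(hR _ _ u.2 y z₀).2, u.2.nonpos₂ z₀ hz₀]⟩
  let v₁ : E → ℝ := fun y => ⨆ u : S, u.1.1 y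
  let v₂ : E → ℝ := fun y => ⨆ u : S, u.1.2 y
  have hub₁ : ∀ (u : S) y, u.1.1 y ≤ v₁ y := fun u y => le_ciSup (hb₁ y) u
  have hub₂ : ∀ (u : S) y, u.1.2 y ≤ v₂ y := fun u y => le_ciSup (hb₂ y) u
  have hc₁ : Continuous v₁ := (LipschitzWith.of_le_add_mul' R fun x y => ciSup_le fun u => by
    have := (hR _ _ u.2 x y).1
    have := hub₁ u y
    rw [dist_eq_norm]
    linarith).continuous
  have hc₂ : Continuous v₂ := (LipschitzWith.of_le_add_mul' R fun x y => ciSup_le fun u => by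
    have := (hR _ _ u.2 x y).2
    have := hub₂ u y
    rw [dist_eq_norm]
    linarith).continuous
  refine ⟨v₁, v₂, hc₁, hc₂, ?_, ?_, fun u₁ u₂ h y => ⟨hub₁ ⟨(u₁, u₂), h⟩ y, hub₂ ⟨(u₁, u₂), h⟩ y⟩,
    fun z hz => ⟨le_antisymm (ciSup_le fun u => u.2.nonpos₁ z hz) (hub₁ u₀ z),
      le_antisymm (ciSup_le fun u => u.2.nonpos₂ z hz) (hub₂ u₀ z)⟩, fun k hk y =>
      ⟨ciSup_le fun u => hub₁ ⟨(_, _), hk _ _ u.2⟩ y, ciSup_le fun u => hub₂ ⟨(_, _), hk _ _ u.2⟩ y⟩⟩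
  · refine .of_approx hG₁ hc₁ hc₂ fun x ε hε => ?_
    obtain ⟨u, hu⟩ := exists_lt_of_lt_ciSup (show v₁ x - ε < ⨆ u : S, u.1.1 x from
      sub_lt_self _ hε)
    exact ⟨_, _, u.2.cont₁, u.2.sub₁, hub₁ u, hub₂ u, hu⟩
  · refine .of_approx hG₂ hc₂ hc₁ fun x ε hε => ?_
    obtain ⟨u, hu⟩ := exists_lt_of_lt_ciSup (show v₂ x - ε < ⨆ u : S, u.1.2 x from
      sub_lt_self _ hε)
    exact ⟨_, _, u.2.cont₂, u.2.sub₂, hub₂ u, hub₁ u, hu⟩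

/-- The first component of a maximal Perron pair is a supersolution off `Z`. -/
theorem IsPerronPair.supersolution (hG₁ : Continuous (Function.uncurry G₁)) (hZ : IsClosed Z)
    (h : IsPerronPair G₁ G₂ Z v₁ v₂)
    (hmax : ∀ u₁ u₂, IsPerronPair G₁ G₂ Z u₁ u₂ → ∀ y, u₁ y ≤ v₁ y) {φ : E → ℝ} {x : E}
    (hx : x ∉ Z) (hφ : ContDiff ℝ 1 φ) (hmin : IsLocalMin (fun y => v₁ y - φ y) x) :
    0 ≤ G₁ x (gradient φ x) + v₁ x - v₂ x := by
  by_contra! hneg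
  obtain ⟨v', hc, hsub, hle, hle1, hout, hlt⟩ := h.sub₁.exists_bump hG₁ h.cont₁ h.cont₂ hφ hmin hneg
    (hZ.isOpen_compl.mem_nhds hx)
  refine hlt.not_ge (hmax v' v₂ ⟨hc, h.cont₂, ?_, h.bdd₂, hsub, ?_, fun z hz => ?_, h.nonpos₂⟩ x)
  · obtain ⟨M, hM⟩ := h.bdd₁
    refine ⟨M + 1, forall_mem_range.2 fun y => ?_⟩
    linarith [hle1 y, hM (mem_range_self y)]
  -- Raising the first component only lowers the left side of the second equation.
  · intro χ y hχ hχmax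
    linarith [h.sub₂ χ y hχ hχmax, hle y]
  · rw [hout z (not_not.2 hz)]
    exact h.nonpos₁ z hz

end Perron

section Torus

/-! ### Descent to the torus, and the two halves of the theorem. -/

variable {n : ℕ}

theorem isOpenQuotientMap_torusProj : IsOpenQuotientMap (torusProj (n := n)) :=
  (IsOpenQuotientMap.piMap fun _ : Fin n => QuotientAddGroup.isOpenQuotientMap_mk).comp
    (EuclideanSpace.equiv (Fin n) ℝ).toHomeomorph.isOpenQuotientMap

theorem torusProj_add (x y : EuclideanSpace ℝ (Fin n)) :
    torusProj (x + y) = torusProj x + torusProj y := by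
  ext i
  simp [torusProj]

theorem torusProj_sub (x y : EuclideanSpace ℝ (Fin n)) :
    torusProj (x - y) = torusProj x - torusProj y := by
  ext i
  simp [torusProj]

/-- A continuous function on `ℝⁿ` that does not increase under lattice translations descends to the
torus. -/
theorem exists_comp_torusProj_eq {v : EuclideanSpace ℝ (Fin n) → ℝ} (hv : Continuous v)
    (h : ∀ k, torusProj k = 0 → ∀ y, v (y + k) ≤ v y) :
    ∃ V : C(UnitAddTorus (Fin n), ℝ), ∀ y, V (torusProj y) = v y := by
  have hq := isOpenQuotientMap_torusProj (n := n)
  have hle : ∀ x y, torusProj x = torusProj y → v x ≤ v y := fun x y hxy => by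
    have := h (x - y) (by rw [torusProj_sub, hxy, sub_self]) y
    rwa [add_sub_cancel] at this
  have hV : ∀ y, v (Function.surjInv hq.surjective (torusProj y)) = v y := fun y =>
    have := Function.surjInv_eq hq.surjective (torusProj y)
    le_antisymm (hle _ _ this) (hle _ _ this.symm)
  refine ⟨⟨fun ξ => v (Function.surjInv hq.surjective ξ), ?_⟩, hV⟩
  rw [← hq.continuous_comp_iff]
  exact hv.congr fun y => (hV y).symm

theorem bddAbove_range_comp_torusProj (V : C(UnitAddTorus (Fin n), ℝ)) :
    BddAbove (range fun y => V (torusProj y)) :=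
  (isCompact_range V.continuous).bddAbove.mono (range_comp_subset_range torusProj V)

/-- A subsolution `v` of an equation with nonnegative `F` satisfies `v - w ≤ f + c` pointwise. -/
theorem sub_le_of_nonneg {F : UnitAddTorus (Fin n) → EuclideanSpace ℝ (Fin n) → ℝ}
    {f : UnitAddTorus (Fin n) → ℝ} (hf : Continuous f) (hF : ∀ x p, 0 ≤ F x p)
    {c : ℝ} {v w : EuclideanSpace ℝ (Fin n) → ℝ} (hv : Continuous v) (hw : Continuous w)
    (hb : BddAbove (range v))
    (h : ∀ (φ : EuclideanSpace ℝ (Fin n) → ℝ) (x : EuclideanSpace ℝ (Fin n)),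
      ContDiff ℝ 1 φ → IsLocalMax (fun y => v y - φ y) x →
        F (torusProj x) (gradient φ x) - f (torusProj x) + v x - w x ≤ c)
    (x : EuclideanSpace ℝ (Fin n)) : v x - w x ≤ f (torusProj x) + c := by
  have hfc := hf.comp (isOpenQuotientMap_torusProj (n := n)).continuous
  have := nonpos_of_isLocalMax hv hb (((hv.sub hw).sub hfc).sub (continuous_const (y := c)))
    (fun φ y hφ hmax => by
      have h1 := h φ y hφ hmax
      have h2 := hF (torusProj y) (gradient φ y)
      change v y - w y - f (torusProj y) - c ≤ 0
      linarith) x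
  change v x - w x - f (torusProj x) - c ≤ 0 at this
  linarith

/-- Coercivity gives a common Lipschitz constant for the subsolutions of the lifted system. -/
theorem exists_lipschitz_constant
    {F₁ F₂ : UnitAddTorus (Fin n) → EuclideanSpace ℝ (Fin n) → ℝ}
    {f₁ f₂ : UnitAddTorus (Fin n) → ℝ} (hf₂ : Continuous f₂)
    (hcoer : IsCoerciveHamiltonian (fun x p => F₁ x p - f₁ x)) (hF₂ : ∀ x p, 0 ≤ F₂ x p)
    (Z : Set (EuclideanSpace ℝ (Fin n))) :
    ∃ R₀ : ℝ, ∀ R, R₀ ≤ R → ∀ u₁ u₂, IsPerronPair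
      (fun x p => F₁ (torusProj x) p - f₁ (torusProj x))
      (fun x p => F₂ (torusProj x) p - f₂ (torusProj x)) Z u₁ u₂ →
        ∀ x y, u₁ x ≤ u₁ y + R * ‖x - y‖ := by
  obtain ⟨M, hM⟩ := (isCompact_range hf₂).bddAbove
  -- The second equation gives `u₂ - u₁ ≤ M`, so the Hamiltonian at a test gradient is at most `M`,
  -- hence below `M + 1`.
  obtain ⟨r, hr⟩ := hcoer (M + 1)
  refine ⟨r, fun R hR u₁ u₂ hu => le_add_mul_norm_of_norm_gradient_le hu.cont₁ hu.bdd₁ ?_⟩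
  intro φ x hφ hmax
  by_contra! hlt
  have h1 := hr (torusProj x) (gradient φ x) (hR.trans hlt.le)
  have h2 := hu.sub₁ φ x hφ hmax
  have h3 := sub_le_of_nonneg hf₂ hF₂ hu.cont₂ hu.cont₁ hu.bdd₂ hu.sub₂ x
  have h4 := hM (mem_range_self (torusProj x))
  simp only at h1 h2
  linarith

theorem isSubsolution_zero {F : UnitAddTorus (Fin n) → EuclideanSpace ℝ (Fin n) → ℝ}
    {f : UnitAddTorus (Fin n) → ℝ} (hf : ∀ x, 0 ≤ f x) (hF : ∀ x, F x 0 = 0) :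
    IsSubsolution (fun x p => F (torusProj x) p - f (torusProj x)) (fun _ => 0) (fun _ => 0) := by
  intro φ x hφ hmax
  rw [← gradient_eq_of_isLocalMax_sub hφ contDiff_const hmax, gradient_fun_const]
  linarith [hf (torusProj x), hF (torusProj x)]

/-- A supersolution `v` of an equation with `F(x, 0) = 0` that attains its minimum at a point
where `v ≤ w` forces `c ≤ 0`. -/
theorem nonpos_of_isViscositySupersolution
    {F : UnitAddTorus (Fin n) → EuclideanSpace ℝ (Fin n) → ℝ} {f : UnitAddTorus (Fin n) → ℝ}
    (hf : ∀ x, 0 ≤ f x) (hF : ∀ x, F x 0 = 0) {c : ℝ} {v w : UnitAddTorus (Fin n) → ℝ}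
    (h : IsViscositySupersolution (fun x p => F x p - f x) c v w) {ξ : UnitAddTorus (Fin n)}
    (hmin : ∀ η, v ξ ≤ v η) (hle : v ξ ≤ w ξ) : c ≤ 0 := by
  obtain ⟨x, rfl⟩ := isOpenQuotientMap_torusProj.surjective ξ
  have := h (fun _ => 0) x contDiff_const (Eventually.of_forall fun y => by simpa using hmin _)
  rw [gradient_fun_const] at this
  linarith [hf (torusProj x), hF (torusProj x)]

theorem isErgodicConstant_zero
    {F₁ F₂ : UnitAddTorus (Fin n) → EuclideanSpace ℝ (Fin n) → ℝ}
    {f₁ f₂ : UnitAddTorus (Fin n) → ℝ}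
    (hF₁ : Continuous (Function.uncurry F₁)) (hF₂ : Continuous (Function.uncurry F₂))
    (hf₁ : Continuous f₁) (hf₂ : Continuous f₂)
    (hcoer₁ : IsCoerciveHamiltonian (fun x p => F₁ x p - f₁ x))
    (hcoer₂ : IsCoerciveHamiltonian (fun x p => F₂ x p - f₂ x))
    (hf₁_nonneg : ∀ x, 0 ≤ f₁ x) (hf₂_nonneg : ∀ x, 0 ≤ f₂ x)
    (hA : ∃ x, f₁ x = 0 ∧ f₂ x = 0)
    (hF₁_nonneg : ∀ x p, 0 ≤ F₁ x p) (hF₂_nonneg : ∀ x p, 0 ≤ F₂ x p)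
    (hF₁_zero : ∀ x, F₁ x 0 = 0) (hF₂_zero : ∀ x, F₂ x 0 = 0) :
    IsErgodicConstant (fun x p => F₁ x p - f₁ x) (fun x p => F₂ x p - f₂ x) 0 := by
  have hq := isOpenQuotientMap_torusProj (n := n)
  obtain ⟨ξ, hξ₁, hξ₂⟩ := hA
  -- One fibre is enough: it anchors the supremum and is invariant under lattice translations.
  set Z : Set (EuclideanSpace ℝ (Fin n)) := torusProj ⁻¹' {ξ} with hZ
  have hZc : IsClosed Z := isClosed_singleton.preimage hq.continuous
  have hZn : Z.Nonempty := hq.surjective ξ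
  have hcont : ∀ {F : UnitAddTorus (Fin n) → EuclideanSpace ℝ (Fin n) → ℝ}
      {f : UnitAddTorus (Fin n) → ℝ}, Continuous (Function.uncurry F) → Continuous f →
      Continuous (Function.uncurry fun x p => F (torusProj x) p - f (torusProj x)) :=
    fun hF hf => (hF.comp ((hq.continuous.comp continuous_fst).prodMk continuous_snd)).sub
      (hf.comp (hq.continuous.comp continuous_fst))
  have hG₁ := hcont hF₁ hf₁
  have hG₂ := hcont hF₂ hf₂
  obtain ⟨R₁, hR₁⟩ := exists_lipschitz_constant hf₂ hcoer₁ hF₂_nonneg Z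
  obtain ⟨R₂, hR₂⟩ := exists_lipschitz_constant hf₁ hcoer₂ hF₁_nonneg Z
  have hbdd0 : BddAbove (range fun _ : EuclideanSpace ℝ (Fin n) => (0 : ℝ)) :=
    ⟨0, forall_mem_range.2 fun _ => le_rfl⟩
  obtain ⟨v₁, v₂, hc₁, hc₂, hs₁, hs₂, hmax, hvZ, hper⟩ := exists_perron_sup hG₁ hG₂ hZn
    (R := max R₁ R₂)
    (fun u₁ u₂ h x y => ⟨hR₁ _ (le_max_left _ _) u₁ u₂ h x y,
      hR₂ _ (le_max_right _ _) u₂ u₁ h.symm x y⟩)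
    ⟨continuous_const, continuous_const, hbdd0, hbdd0, isSubsolution_zero hf₁_nonneg hF₁_zero,
      isSubsolution_zero hf₂_nonneg hF₂_zero, fun _ _ => le_rfl, fun _ _ => le_rfl⟩
  -- Competitors need not be periodic; the supremum is, because the class is translation invariant.
  have hper' : ∀ k, torusProj k = 0 → ∀ y, v₁ (y + k) ≤ v₁ y ∧ v₂ (y + k) ≤ v₂ y := by
    intro k hk
    have hadd : ∀ y, torusProj (y + k) = torusProj y := fun y => by
      rw [torusProj_add, hk, add_zero]
    refine hper k fun u₁ u₂ h => h.comp_add_right ?_ ?_ ?_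
    · exact fun x p => by rw [hadd]
    · exact fun x p => by rw [hadd]
    · exact fun z hz => (hadd z).trans hz
  obtain ⟨V₁, hV₁⟩ := exists_comp_torusProj_eq hc₁ fun k hk y => (hper' k hk y).1
  obtain ⟨V₂, hV₂⟩ := exists_comp_torusProj_eq hc₂ fun k hk y => (hper' k hk y).2
  obtain rfl : (fun y => V₁ (torusProj y)) = v₁ := funext hV₁
  obtain rfl : (fun y => V₂ (torusProj y)) = v₂ := funext hV₂
  have hpair : IsPerronPair (fun x p => F₁ (torusProj x) p - f₁ (torusProj x))
      (fun x p => F₂ (torusProj x) p - f₂ (torusProj x)) Z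
      (fun y => V₁ (torusProj y)) (fun y => V₂ (torusProj y)) :=
    ⟨hc₁, hc₂, bddAbove_range_comp_torusProj V₁, bddAbove_range_comp_torusProj V₂, hs₁, hs₂,
      fun z hz => (hvZ z hz).1.le, fun z hz => (hvZ z hz).2.le⟩
  refine ⟨V₁, V₂, hs₁, fun φ x hφ hmin => ?_, hs₂, fun φ x hφ hmin => ?_⟩
  · by_cases hx : x ∈ Z
    · obtain ⟨h1, h2⟩ := hvZ x hx
      have hxξ : torusProj x = ξ := hx
      simp only [hxξ] at h1 h2 ⊢
      linarith [hF₁_nonneg ξ (gradient φ x)]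
    · exact hpair.supersolution hG₁ hZc (fun u₁ u₂ h y => (hmax u₁ u₂ h y).1) hx hφ hmin
  · by_cases hx : x ∈ Z
    · obtain ⟨h1, h2⟩ := hvZ x hx
      have hxξ : torusProj x = ξ := hx
      simp only [hxξ] at h1 h2 ⊢
      linarith [hF₂_nonneg ξ (gradient φ x)]
    · exact hpair.symm.supersolution hG₂ hZc (fun u₂ u₁ h y => (hmax u₁ u₂ h.symm y).2) hx hφ hmin

theorem eq_zero_of_isErgodicConstant
    {F₁ F₂ : UnitAddTorus (Fin n) → EuclideanSpace ℝ (Fin n) → ℝ}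
    {f₁ f₂ : UnitAddTorus (Fin n) → ℝ} (hf₁ : Continuous f₁) (hf₂ : Continuous f₂)
    (hf₁_nonneg : ∀ x, 0 ≤ f₁ x) (hf₂_nonneg : ∀ x, 0 ≤ f₂ x)
    (hA : ∃ x, f₁ x = 0 ∧ f₂ x = 0)
    (hF₁_nonneg : ∀ x p, 0 ≤ F₁ x p) (hF₂_nonneg : ∀ x p, 0 ≤ F₂ x p)
    (hF₁_zero : ∀ x, F₁ x 0 = 0) (hF₂_zero : ∀ x, F₂ x 0 = 0) {c : ℝ}
    (hc : IsErgodicConstant (fun x p => F₁ x p - f₁ x) (fun x p => F₂ x p - f₂ x) c) : c = 0 := by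
  have hq := isOpenQuotientMap_torusProj (n := n)
  obtain ⟨V₁, V₂, hs₁, hS₁, hs₂, hS₂⟩ := hc
  refine le_antisymm ?_ ?_
  · obtain ⟨ξ₁, -, h₁⟩ := isCompact_univ.exists_isMinOn univ_nonempty
      V₁.continuous.continuousOn
    replace h₁ : ∀ η, V₁ ξ₁ ≤ V₁ η := fun η => h₁ (mem_univ η)
    obtain ⟨ξ₂, -, h₂⟩ := isCompact_univ.exists_isMinOn univ_nonempty
      V₂.continuous.continuousOn
    replace h₂ : ∀ η, V₂ ξ₂ ≤ V₂ η := fun η => h₂ (mem_univ η)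
    -- At a minimum point of the component with the smaller minimum, the coupling term is
    -- nonpositive.
    rcases le_total (V₁ ξ₁) (V₂ ξ₂) with h | h
    · exact nonpos_of_isViscositySupersolution hf₁_nonneg hF₁_zero hS₁ h₁ (h.trans (h₂ ξ₁))
    · exact nonpos_of_isViscositySupersolution hf₂_nonneg hF₂_zero hS₂ h₂ (h.trans (h₁ ξ₂))
  · obtain ⟨ξ, hξ₁, hξ₂⟩ := hA
    obtain ⟨x, rfl⟩ := hq.surjective ξ
    have hc₁ := V₁.continuous.comp hq.continuous
    have hc₂ := V₂.continuous.comp hq.continuous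
    have h1 := sub_le_of_nonneg hf₁ hF₁_nonneg hc₁ hc₂ (bddAbove_range_comp_torusProj V₁) hs₁ x
    have h2 := sub_le_of_nonneg hf₂ hF₂_nonneg hc₂ hc₁ (bddAbove_range_comp_torusProj V₂) hs₂ x
    rw [hξ₁] at h1
    rw [hξ₂] at h2
    -- Both `fᵢ` vanish here, so adding the two bounds gives `0 ≤ 2 * c`.
    linarith

end Torus

theorem proposition3p1 {n : ℕ}
    (F₁ F₂ : UnitAddTorus (Fin n) → EuclideanSpace ℝ (Fin n) → ℝ)
    (f₁ f₂ : UnitAddTorus (Fin n) → ℝ)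
    (hF₁ : Continuous (Function.uncurry F₁)) (hF₂ : Continuous (Function.uncurry F₂))
    (hf₁ : Continuous f₁) (hf₂ : Continuous f₂)
    -- coercivity of the Hamiltonians `Hᵢ = Fᵢ - fᵢ`
    (hcoer₁ : IsCoerciveHamiltonian (fun x p => F₁ x p - f₁ x))
    (hcoer₂ : IsCoerciveHamiltonian (fun x p => F₂ x p - f₂ x))
    -- nonnegativity of the `fᵢ`
    (hf₁_nonneg : ∀ x, 0 ≤ f₁ x) (hf₂_nonneg : ∀ x, 0 ≤ f₂ x)
    -- the common zero set `𝒜` of the `fᵢ` is nonempty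
    (hA : ∃ x, f₁ x = 0 ∧ f₂ x = 0)
    -- `Fᵢ(x, l p) ≤ l Fᵢ(x, p)` off `𝒜`, for `l` close to `1`
    (hdir : ∃ l₀ : ℝ, 0 < l₀ ∧ l₀ < 1 ∧ ∀ l : ℝ, l₀ ≤ l → l ≤ 1 →
      ∀ x, ¬ (f₁ x = 0 ∧ f₂ x = 0) → ∀ p : EuclideanSpace ℝ (Fin n),
        F₁ x (l • p) ≤ l * F₁ x p ∧ F₂ x (l • p) ≤ l * F₂ x p)
    -- `Fᵢ ≥ 0` and `Fᵢ(x, 0) = 0`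
    (hF₁_nonneg : ∀ x p, 0 ≤ F₁ x p) (hF₂_nonneg : ∀ x p, 0 ≤ F₂ x p)
    (hF₁_zero : ∀ x, F₁ x 0 = 0) (hF₂_zero : ∀ x, F₂ x 0 = 0) :
    -- the ergodic constant exists, is unique, and equals 0
    IsErgodicConstant (fun x p => F₁ x p - f₁ x) (fun x p => F₂ x p - f₂ x) 0 ∧
      ∀ c : ℝ, IsErgodicConstant (fun x p => F₁ x p - f₁ x) (fun x p => F₂ x p - f₂ x) c →
        c = 0 := by
  exact ⟨isErgodicConstant_zero hF₁ hF₂ hf₁ hf₂ hcoer₁ hcoer₂ hf₁_nonneg hf₂_nonneg hA hF₁_nonneg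
      hF₂_nonneg hF₁_zero hF₂_zero,
    fun _ hc => eq_zero_of_isErgodicConstant hf₁ hf₂ hf₁_nonneg hf₂_nonneg hA hF₁_nonneg hF₂_nonneg
      hF₁_zero hF₂_zero hc⟩
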